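/- Let $p$ be an odd prime, and let $\phi$ be the quadratic character of $\mathbb F_p$. Let $K_{-1}$ and $L_{-1}$ be the surfaces in the weighted projective space $\mathbb P(3,1,1,1)$ over $\mathbb F_p$, with coordinates $v,z_0,z_1,z_2$, defined respectively by $$v^2 = z_0z_1z_2(-z_0+z_1)(z_1+z_2)(z_0+z_2), \qquad v^2 = -z_0z_1z_2(z_0+z_1)(-z_0+z_2)(z_1+z_2).$$ Let $F_1$ be the fivefold in $\mathbb P(6,1,1,1,1,1,1)$ over $\mathbb F_p$, with coordinates $t,x_0,\dots,x_5$, defined by $t^2=\prod_{i=0}^5 x_i(x_i+x_{i+1})$ (indices modulo $6$), and let $F_{-1}$ be the affine patch $x_3\neq 0$ of the fibre above $(-1:1)$ of the rational map $(x_0:x_3)\colon F_1 \dashrightarrow \mathbb P^1$; that is, $F_{-1}$ is the locus $x_0=-x_3$, $x_3\ne 0$ in $F_1$. Let $a_{-1,p} = p+1-\#E(\mathbb F_p)$, where $E$ is the elliptic curve $y^2=x^3-x$ (the point at infinity is counted). Then $$\#K_{-1}(\mathbb F_p) = \#L_{-1}(\mathbb F_p) = p^2-\phi(-1)p+1+a_{-1,p}^2,$$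 $$\#F_{-1}(\mathbb F_p) = p^4+(2p-a_{-1,p}^2)^2 \ \text{ if } p\equiv 1 \bmod 4, \qquad \#F_{-1}(\mathbb F_p) = p^4 \ \text{ if } p\equiv 3\bmod 4.$$ -/

import Mathlib

open MvPolynomial

/-- Two nonzero tuples over `k` represent the same point of the weighted projective space
with weights `w` iff they are related, over the algebraic closure, by the weighted scaling
`x i ↦ c ^ w i * x i`. -/
def weightedSetoid {ι : Type} (w : ι → ℕ) (k : Type) [Field k] :
    Setoid {x : ι → k // x ≠ 0} where
  r x y := ∃ c : AlgebraicClosure k, c ≠ 0 ∧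
    ∀ i, algebraMap k (AlgebraicClosure k) (y.1 i) =
      c ^ w i * algebraMap k (AlgebraicClosure k) (x.1 i)
  iseqv :=
    { refl := fun _ => ⟨1, one_ne_zero, fun i => by simp⟩
      symm := by
        rintro x y ⟨c, hc, h⟩
        refine ⟨c⁻¹, inv_ne_zero hc, fun i => ?_⟩
        rw [h i, ← mul_assoc, ← mul_pow, inv_mul_cancel₀ hc, one_pow, one_mul]
      trans := by
        rintro x y z ⟨c, hc, h⟩ ⟨d, hd, h'⟩
        refine ⟨d * c, mul_ne_zero hd hc, fun i => ?_⟩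
        rw [h' i, h i, mul_pow, mul_assoc] }

/-- The set of `k`-rational points of the weighted projective space with weights `w`. -/
def WeightedProjectiveSpace {ι : Type} (w : ι → ℕ) (k : Type) [Field k] : Type :=
  Quotient (weightedSetoid w k)

/-- The point with weighted homogeneous coordinates `x`. -/
def WeightedProjectiveSpace.mk {ι : Type} (w : ι → ℕ) {k : Type} [Field k]
    (x : {x : ι → k // x ≠ 0}) : WeightedProjectiveSpace w k :=
  Quotient.mk (weightedSetoid w k) x

/-- The set of `k`-rational points of the hypersurface `f = 0` in weighted projective space,
for a weighted homogeneous polynomial `f` with integer coefficients. -/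
def weightedHypersurface {ι : Type} (w : ι → ℕ) (f : MvPolynomial ι ℤ) (k : Type) [Field k] :
    Set (WeightedProjectiveSpace w k) :=
  {P | ∀ x : {x : ι → k // x ≠ 0}, WeightedProjectiveSpace.mk w x = P → aeval x.1 f = 0}

/-- The weights `(d, 1, …, 1)`: the coordinate `none` has weight `d`, and the coordinates
`some i` have weight `1`. -/
def coverWeight {ι : Type} (d : ℕ) : Option ι → ℕ
  | none => d
  | some _ => 1

/-- The surface `v² = z₀ z₁ z₂ (-z₀ + z₁) (z₁ + z₂) (z₀ + z₂)` in `ℙ(3,1,1,1)`: its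
`k`-rational points. Here `v` is the coordinate `none` and `zᵢ` the coordinate `some i`. -/
def surfaceK (k : Type) [Field k] :
    Set (WeightedProjectiveSpace (coverWeight 3 : Option (Fin 3) → ℕ) k) :=
  weightedHypersurface (coverWeight 3)
    (X none ^ 2 - X (some 0) * X (some 1) * X (some 2) * (-X (some 0) + X (some 1)) *
      (X (some 1) + X (some 2)) * (X (some 0) + X (some 2))) k

/-- The surface `v² = -z₀ z₁ z₂ (z₀ + z₁) (-z₀ + z₂) (z₁ + z₂)` in `ℙ(3,1,1,1)`: its
`k`-rational points. -/
def surfaceL (k : Type) [Field k] :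
    Set (WeightedProjectiveSpace (coverWeight 3 : Option (Fin 3) → ℕ) k) :=
  weightedHypersurface (coverWeight 3)
    (X none ^ 2 - -(X (some 0) * X (some 1) * X (some 2) * (X (some 0) + X (some 1)) *
      (-X (some 0) + X (some 2)) * (X (some 1) + X (some 2)))) k

/-- The fivefold `t² = ∏ i, xᵢ (xᵢ + xᵢ₊₁)` (indices modulo `6`) in `ℙ(6,1,1,1,1,1,1)`: its
`k`-rational points. -/
def fivefold (k : Type) [Field k] :
    Set (WeightedProjectiveSpace (coverWeight 6 : Option (Fin 6) → ℕ) k) :=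
  weightedHypersurface (coverWeight 6)
    (X none ^ 2 - ∏ i : Fin 6, X (some i) * (X (some i) + X (some (i + 1)))) k

/-- The affine patch `x₃ ≠ 0` of the fibre above `(lam : 1)` of the rational map `(x₀ : x₃)`
from the fivefold to `ℙ¹`: its `k`-rational points. -/
def fivefoldFibre (k : Type) [Field k] (lam : k) :
    Set (WeightedProjectiveSpace (coverWeight 6 : Option (Fin 6) → ℕ) k) :=
  {P | P ∈ fivefold k ∧ ∀ x : {x : Option (Fin 6) → k // x ≠ 0},
    WeightedProjectiveSpace.mk (coverWeight 6) x = P →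
      x.1 (some 3) ≠ 0 ∧ x.1 (some 0) = lam * x.1 (some 3)}

/-- The elliptic curve `y² = x³ - x`. -/
def curveE (k : Type) [Field k] : WeierstrassCurve.Affine k :=
  { a₁ := 0, a₂ := 0, a₃ := 0, a₄ := -1, a₆ := 0 }

/-- The trace of Frobenius `p + 1 - #E(𝔽_p)` of `y² = x³ - x`; the point at infinity is
counted. -/
noncomputable def frobTrace (p : ℕ) [Fact p.Prime] : ℤ :=
  (p : ℤ) + 1 - Nat.card (curveE (ZMod p)).Point

/-! ### Quadratic character sums and the identity relating the elliptic curve to six lines -/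

section CharacterSums

variable {k : Type} [Field k] [Fintype k] [DecidableEq k]

/-! Let `q` be the size of the field, φ its quadratic character, S = `sixLineSum`. Everything
reduces to S. Both surfaces are double covers of the plane branched along six lines, and each has q²
+ q + 1 + S points. On the fibre, x₀ and x₃ are opposite in the 6-cycle; normalising x₃ = 1, x₀ = -1
cuts the cycle into two paths, so the character sum factors as φ(-1)S² and the count is q⁴ +
φ(-1)S². The link with E is `cubicSum_sq`: a² = (1 + φ(-1))q + S, where a = -`cubicSum` is the trace
of Frobenius. Finally S = φ(-1)S by a symmetry of the six lines, so S = 0 when p ≡ 3 mod 4. -/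

theorem quadraticChar_sq_mul {a : k} (ha : a ≠ 0) (b : k) :
    quadraticChar k (a ^ 2 * b) = quadraticChar k b := by
  rw [map_mul, quadraticChar_sq_one' ha, one_mul]

theorem sum_quadraticChar_sub (hk : ringChar k ≠ 2) (a : k) :
    ∑ x : k, quadraticChar k (x - a) = 0 := by
  rw [← quadraticChar_sum_zero hk]
  exact (Equiv.subRight a).sum_comp (fun x => quadraticChar k x)

theorem sum_quadraticChar_mul_add (hk : ringChar k ≠ 2) {a : k} (ha : a ≠ 0) (b : k) :
    ∑ x : k, quadraticChar k (a * x + b) = 0 := by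
  rw [← quadraticChar_sum_zero hk]
  exact ((Equiv.mulLeft₀ a ha).trans (Equiv.addRight b)).sum_comp (fun x => quadraticChar k x)

/-- A change of variables along `x ↦ x⁻¹`, away from zero. -/
theorem sum_quadraticChar_sq_mul_inv (f : k → ℤ) :
    ∑ x : k, quadraticChar k x ^ 2 * f x⁻¹ = ∑ x : k, quadraticChar k x ^ 2 * f x := by
  rw [← Equiv.sum_comp (Equiv.inv k)]
  refine Finset.sum_congr rfl fun x _ => ?_
  rcases eq_or_ne x 0 with rfl | hx
  · simp
  · simp only [Equiv.inv_apply, inv_inv, quadraticChar_sq_one hx,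
      quadraticChar_sq_one (inv_ne_zero hx)]

/-- The square of φ is the indicator of the nonzero elements; it serves as that weight throughout.
-/
theorem sum_quadraticChar_sq_mul (f : k → ℤ) :
    ∑ x : k, quadraticChar k x ^ 2 * f x = ∑ x : k, f x - f 0 := by
  rw [eq_sub_iff_add_eq, ← Finset.sum_erase_add _ _ (Finset.mem_univ (0 : k)),
    ← Finset.sum_erase_add (a := (0 : k)) _ f (Finset.mem_univ (0 : k))]
  have : ∀ x ∈ Finset.univ.erase (0 : k), quadraticChar k x ^ 2 * f x = f x := fun x hx => by
    rw [quadraticChar_sq_one (Finset.ne_of_mem_erase hx), one_mul]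
  rw [Finset.sum_congr rfl this]
  simp

/-- Since x(x + d) = x²(1 + d/x), inversion turns the sum into a linear one with the term at 0
removed. -/
theorem sum_quadraticChar_mul_self_add (hk : ringChar k ≠ 2) {d : k} (hd : d ≠ 0) :
    ∑ x : k, quadraticChar k (x * (x + d)) = -1 := by
  have h : ∀ x : k, quadraticChar k (x * (x + d)) =
      quadraticChar k x ^ 2 * quadraticChar k (d * x⁻¹ + 1) := fun x => by
    rcases eq_or_ne x 0 with rfl | hx
    · simp
    · rw [← map_pow, ← map_mul]
      congr 1
      field_simp
      ring
  simp_rw [h]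
  rw [sum_quadraticChar_sq_mul_inv (fun x => quadraticChar k (d * x + 1)),
    sum_quadraticChar_sq_mul, sum_quadraticChar_mul_add hk hd]
  simp

theorem sum_quadraticChar_conic (hk : ringChar k ≠ 2) (a b : k) :
    ∑ x : k, quadraticChar k ((x - a) * (x - b)) =
      if a = b then (Fintype.card k : ℤ) - 1 else -1 := by
  rw [← Equiv.sum_comp (Equiv.addRight a)]
  split_ifs with h
  · subst h
    have := sum_quadraticChar_sq_mul (k := k) (fun _ => 1)
    simp only [mul_one] at this
    simpa [← pow_two, -quadraticChar_apply] using this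
  · rw [← sum_quadraticChar_mul_self_add hk (sub_ne_zero.2 h)]
    refine Finset.sum_congr rfl fun x _ => ?_
    simp [add_sub_assoc]

/-- Summation along the fibres of a map. -/
theorem sum_mul_comp_eq {k : Type} [Fintype k] [DecidableEq k] (w : k → ℤ) (h : k → k) (f : k → ℤ) :
    ∑ x : k, w x * f (h x) = ∑ m : k, (∑ x : k, if h x = m then w x else 0) * f m := by
  simp_rw [Finset.sum_mul]
  rw [Finset.sum_comm]
  refine Finset.sum_congr rfl fun x _ => ?_
  simp

theorem sum_ite_sq_eq (hk : ringChar k ≠ 2) (a : k) :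
    ∑ x : k, (if x ^ 2 = a then 1 else 0 : ℤ) = 1 + quadraticChar k a := by
  rw [add_comm, ← quadraticChar_card_sqrts hk a]
  simp

theorem sum_comp_sq (hk : ringChar k ≠ 2) (f : k → ℤ) :
    ∑ x : k, f (x ^ 2) = ∑ y : k, (1 + quadraticChar k y) * f y := by
  have := sum_mul_comp_eq (fun _ : k => 1) (fun x => x ^ 2) f
  simpa only [one_mul, sum_ite_sq_eq hk] using this

/-- For x ≠ 0, x + x⁻¹ = m means (2x - m)² = m² - 4, so the fibre size is read off the discriminant.
-/
theorem sum_comp_add_inv (hk : ringChar k ≠ 2) (f : k → ℤ) :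
    ∑ x : k, quadraticChar k x ^ 2 * f (x + x⁻¹) =
      ∑ m : k, (1 + quadraticChar k (m ^ 2 - 4)) * f m := by
  have h2 : (2 : k) ≠ 0 := Ring.two_ne_zero hk
  rw [sum_mul_comp_eq]
  refine Finset.sum_congr rfl fun m _ => ?_
  rw [← sum_ite_sq_eq hk, ← Equiv.sum_comp ((Equiv.mulLeft₀ (2 : k) h2).trans (Equiv.subRight m))
    (fun x => if x ^ 2 = m ^ 2 - 4 then (1 : ℤ) else 0)]
  congr 1
  refine Finset.sum_congr rfl fun x _ => ?_
  rcases eq_or_ne x 0 with rfl | hx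
  · have : m ^ 2 ≠ m ^ 2 - 4 := fun h => by
      apply pow_ne_zero 2 h2
      linear_combination h
    simp [this]
  · rw [quadraticChar_sq_one hx]
    congr 1
    simp only [Equiv.trans_apply, Equiv.mulLeft₀_apply, Equiv.subRight_apply, eq_iff_iff]
    constructor
    · rintro rfl
      field_simp
      ring
    · intro h
      have : (2 : k) ^ 2 * (x ^ 2 + 1 - m * x) = 0 := by linear_combination h
      have := (mul_eq_zero.1 this).resolve_left (pow_ne_zero 2 h2)
      field_simp
      linear_combination this

/-- The character sum attached to the double cover of the plane branched along the six lines
`x = 0`, `y = 0`, `x = 1`, `y = -1`, `x = -y` and the line at infinity. -/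
def sixLineSum (k : Type) [Field k] [Fintype k] [DecidableEq k] : ℤ :=
  ∑ x : k, ∑ y : k, quadraticChar k (x * y * (x - 1) * (x + y) * (y + 1))

/-- The character sum attached to `y² = x³ - x`. -/
def cubicSum (k : Type) [Field k] [Fintype k] [DecidableEq k] : ℤ :=
  ∑ x : k, quadraticChar k (x ^ 3 - x)

theorem sixLineSum_eq_neg :
    sixLineSum k = ∑ x : k, ∑ y : k, quadraticChar k (x * y * (x + 1) * (y - x) * (y + 1)) := by
  unfold sixLineSum
  rw [← Equiv.sum_comp (Equiv.neg k)]
  refine Finset.sum_congr rfl fun x _ => Finset.sum_congr rfl fun y _ => ?_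
  congr 1
  simp only [Equiv.neg_apply]
  ring

/-- In the form of `sixLineSum_eq_neg`, exchanging x and y changes only the sign of the factor y -
x. -/
theorem sixLineSum_eq_quadraticChar_neg_one_mul :
    sixLineSum k = quadraticChar k (-1) * sixLineSum k := by
  conv_rhs => rw [sixLineSum_eq_neg]
  rw [sixLineSum_eq_neg, Finset.mul_sum]
  conv_lhs => rw [Finset.sum_comm]
  refine Finset.sum_congr rfl fun x _ => ?_
  rw [Finset.mul_sum]
  refine Finset.sum_congr rfl fun y _ => ?_
  rw [← map_mul]
  congr 1
  ring

/-- Push forward to m = x + x⁻¹ and n = s + s⁻¹. The parts of the fibre counts equal to 1 leave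
linear sums, which vanish; what remains is the sum of φ((m² - 4)(n² - 4)(m - n)). -/
theorem sum_quadraticChar_add_inv_sub_add_inv (hk : ringChar k ≠ 2) :
    ∑ s : k, quadraticChar k s ^ 2 * ∑ x : k, quadraticChar k x ^ 2 *
      quadraticChar k (x + x⁻¹ - (s + s⁻¹)) = sixLineSum k := by
  have h2 : (2 : k) ≠ 0 := Ring.two_ne_zero hk
  have h4 : (4 : k) ≠ 0 := by
    have := mul_ne_zero h2 h2
    norm_num at this
    exact this
  have hin : ∀ s : k, ∑ x : k, quadraticChar k x ^ 2 * quadraticChar k (x + x⁻¹ - (s + s⁻¹)) =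
      ∑ m : k, quadraticChar k (m ^ 2 - 4) * quadraticChar k (m - (s + s⁻¹)) := fun s => by
    rw [sum_comp_add_inv hk (fun m => quadraticChar k (m - (s + s⁻¹)))]
    simp_rw [add_mul, one_mul]
    rw [Finset.sum_add_distrib, sum_quadraticChar_sub hk, zero_add]
  simp_rw [hin]
  rw [sum_comp_add_inv hk
    (fun n => ∑ m : k, quadraticChar k (m ^ 2 - 4) * quadraticChar k (m - n))]
  simp_rw [add_mul, one_mul]
  rw [Finset.sum_add_distrib, Finset.sum_comm]
  have hz : ∀ m : k, ∑ n : k, quadraticChar k (m ^ 2 - 4) * quadraticChar k (m - n) = 0 :=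
    fun m => by
      rw [← Finset.mul_sum]
      have := sum_quadraticChar_mul_add hk (neg_ne_zero.2 one_ne_zero) m
      simp_rw [neg_one_mul, neg_add_eq_sub] at this
      rw [this, mul_zero]
  simp_rw [hz]
  rw [Finset.sum_const_zero, zero_add, sixLineSum_eq_neg]
  -- m = 4y + 2 sends the roots 2, -2 of m² - 4 to 0, -1; the five linear factors contribute 4⁵ =
  -- (2⁵)².
  let e : k ≃ k := (Equiv.mulLeft₀ (4 : k) h4).trans (Equiv.addRight 2)
  rw [← Equiv.sum_comp e]
  refine Finset.sum_congr rfl fun x _ => ?_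
  rw [Finset.mul_sum, ← Equiv.sum_comp e]
  refine Finset.sum_congr rfl fun y _ => ?_
  rw [← quadraticChar_sq_mul (pow_ne_zero 5 h2) (x * y * (x + 1) * (y - x) * (y + 1)),
    ← map_mul, ← map_mul]
  congr 1
  simp only [e, Equiv.trans_apply, Equiv.mulLeft₀_apply, Equiv.coe_addRight]
  ring

/-- Writing the second variable as us makes the summand a function of u². Replacing u² by u with
weight 1 + φ(u) splits the sum: weight 1 gives conics (`hC`), weight φ(u) gives S (`hT`). -/
theorem cubicSum_sq (hk : ringChar k ≠ 2) :
    cubicSum k ^ 2 = (1 + quadraticChar k (-1)) * Fintype.card k + sixLineSum k := by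
  have hstep : cubicSum k ^ 2 = ∑ s : k, ∑ u : k, quadraticChar k (u ^ 2) ^ 2 *
      quadraticChar k (s * (u ^ 2 - 1) * (u ^ 2 * s ^ 2 - 1)) := by
    rw [pow_two, cubicSum, Finset.sum_mul, Finset.sum_comm]
    refine Finset.sum_congr rfl fun u _ => ?_
    rw [Finset.mul_sum]
    rcases eq_or_ne u 0 with rfl | hu
    · simp
    · rw [← Equiv.sum_comp (Equiv.mulLeft₀ u hu)]
      refine Finset.sum_congr rfl fun s _ => ?_
      rw [quadraticChar_sq_one (pow_ne_zero 2 hu), one_mul, ← map_mul,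
        ← quadraticChar_sq_mul hu (s * (u ^ 2 - 1) * (u ^ 2 * s ^ 2 - 1))]
      congr 1
      simp only [Equiv.mulLeft₀_apply]
      ring
  have hT : ∀ s : k, ∑ u : k, quadraticChar k (u * (s * (u - 1) * (u * s ^ 2 - 1))) =
      quadraticChar k s ^ 2 * ∑ x : k, quadraticChar k x ^ 2 *
      quadraticChar k (x + x⁻¹ - (s + s⁻¹)) := fun s => by
    rcases eq_or_ne s 0 with rfl | hs
    · simp
    -- With u = x/s the argument becomes x²(x + x⁻¹ - s - s⁻¹).
    · rw [← Equiv.sum_comp (Equiv.mulLeft₀ s⁻¹ (inv_ne_zero hs)), quadraticChar_sq_one hs, one_mul]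
      refine Finset.sum_congr rfl fun x _ => ?_
      rcases eq_or_ne x 0 with rfl | hx
      · simp
      · rw [← map_pow, ← map_mul]
        congr 1
        simp only [Equiv.mulLeft₀_apply]
        field_simp
        ring
  have hC : ∀ s : k, ∑ u : k, quadraticChar k u ^ 2 *
      quadraticChar k (s * (u - 1) * (u * s ^ 2 - 1)) =
      (if s = 1 then (Fintype.card k : ℤ) else 0) +
      (if s = -1 then quadraticChar k (-1) * Fintype.card k else 0) - 2 * quadraticChar k s :=
    fun s => by
      rcases eq_or_ne s 0 with rfl | hs
      · simp
      · rw [sum_quadraticChar_sq_mul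
          (fun u => quadraticChar k (s * (u - 1) * (u * s ^ 2 - 1)))]
        -- The roots 1 and s⁻² coincide exactly for s = ±1, the only source of the terms in q.
        have h : ∀ u : k, quadraticChar k (s * (u - 1) * (u * s ^ 2 - 1)) =
            quadraticChar k s * quadraticChar k ((u - 1) * (u - (s⁻¹) ^ 2)) := fun u => by
          rw [← map_mul, ← quadraticChar_sq_mul hs (s * _)]
          congr 1
          field_simp
        simp_rw [h]
        rw [← Finset.mul_sum, sum_quadraticChar_conic hk]
        have h11 : (1 : k) ≠ -1 := fun h => by
          apply Ring.two_ne_zero hk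
          linear_combination h
        by_cases h1 : s = 1
        · subst h1
          simp [h11]
          ring
        by_cases h1' : s = -1
        · subst h1'
          simp [h11.symm]
          ring
        have : ¬ (1 = s⁻¹ ^ 2) := fun h => by
          rw [inv_pow, eq_comm, inv_eq_one] at h
          exact (mul_self_eq_one_iff.1 (pow_two s ▸ h)).elim h1 h1'
        rw [if_neg h1, if_neg h1', if_neg this]
        have hinv := quadraticChar_sq_one' (inv_ne_zero hs)
        simp [-quadraticChar_apply, -inv_pow, hinv]
        ring
  rw [hstep]
  simp_rw [fun s : k => sum_comp_sq hk (fun u => quadraticChar k u ^ 2 *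
      quadraticChar k (s * (u - 1) * (u * s ^ 2 - 1)))]
  have hcube : ∀ u s : k, (1 + quadraticChar k u) * (quadraticChar k u ^ 2 *
      quadraticChar k (s * (u - 1) * (u * s ^ 2 - 1))) = quadraticChar k u ^ 2 *
      quadraticChar k (s * (u - 1) * (u * s ^ 2 - 1)) +
      quadraticChar k (u * (s * (u - 1) * (u * s ^ 2 - 1))) := fun u s => by
    rcases eq_or_ne u 0 with rfl | hu
    · simp
    · rw [quadraticChar_sq_one hu, map_mul _ u]
      ring
  simp_rw [hcube, Finset.sum_add_distrib, hT]
  rw [sum_quadraticChar_add_inv_sub_add_inv hk]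
  simp_rw [hC]
  rw [Finset.sum_sub_distrib, Finset.sum_add_distrib, ← Finset.mul_sum, quadraticChar_sum_zero hk]
  simp
  ring

end CharacterSums

/-! ### From points of weighted projective space to the affine cone -/

section Cone

variable {ι : Type} {k : Type} [Field k]

theorem WeightedProjectiveSpace.mk_eq_mk_iff {w : ι → ℕ} {x y : {x : ι → k // x ≠ 0}} :
    WeightedProjectiveSpace.mk w x = WeightedProjectiveSpace.mk w y ↔
      ∃ c : AlgebraicClosure k, c ≠ 0 ∧ ∀ i, algebraMap k (AlgebraicClosure k) (y.1 i) =
        c ^ w i * algebraMap k (AlgebraicClosure k) (x.1 i) :=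
  Quotient.eq (r := weightedSetoid w k)

/-- Membership in a hypersurface can be tested on one representative, for a polynomial that is
semi-invariant under weighted scaling. -/
theorem mk_mem_weightedHypersurface_iff {w : ι → ℕ} {f : MvPolynomial ι ℤ} {n : ℕ}
    (hf : ∀ (x y : ι → AlgebraicClosure k) (c : AlgebraicClosure k),
      (∀ i, y i = c ^ w i * x i) → aeval y f = c ^ n * aeval x f)
    (x : {x : ι → k // x ≠ 0}) :
    WeightedProjectiveSpace.mk w x ∈ weightedHypersurface w f k ↔ aeval x.1 f = 0 := by
  refine ⟨fun h => h x rfl, fun h y hy => ?_⟩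
  obtain ⟨c, hc, hyx⟩ := WeightedProjectiveSpace.mk_eq_mk_iff.1 hy
  have := hf _ _ c hyx
  have hx : ∀ z : ι → k, aeval (fun i => algebraMap k (AlgebraicClosure k) (z i)) f =
      algebraMap k (AlgebraicClosure k) (aeval z f) := fun z => aeval_algebraMap_apply _ z f
  rw [hx, hx, h, map_zero, eq_comm] at this
  exact (map_eq_zero _).1 ((mul_eq_zero.1 this).resolve_left (pow_ne_zero n hc))

/-- Points of a double cover with a nonvanishing coordinate of weight one are represented uniquely
up to scaling by units of the base field. -/
theorem card_units_mul_card_eq_card_cone {d : ℕ}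
    {S : Set (WeightedProjectiveSpace (coverWeight d : Option ι → ℕ) k)}
    {P : (Option ι → k) → Prop} (hP : ∀ x, P x → ∃ i, x (some i) ≠ 0)
    (hS : ∀ x : {x : Option ι → k // x ≠ 0},
      WeightedProjectiveSpace.mk (coverWeight d) x ∈ S ↔ P x.1) :
    Nat.card S * Nat.card kˣ = Nat.card {x : Option ι → k // P x} := by
  have hP0 : ∀ x, P x → x ≠ 0 := by
    rintro x hx rfl
    obtain ⟨i, hi⟩ := hP _ hx
    exact hi rfl
  have hout : ∀ s : WeightedProjectiveSpace (coverWeight d : Option ι → ℕ) k,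
      WeightedProjectiveSpace.mk (coverWeight d) (Quotient.out s) = s := fun s => Quotient.out_eq s
  let scale (c : kˣ) (x : Option ι → k) : Option ι → k := fun i => (c : k) ^ coverWeight d i * x i
  have hscale0 : ∀ (c : kˣ) (x : Option ι → k), x ≠ 0 → scale c x ≠ 0 := by
    intro c x hx h
    refine hx (funext fun i => ?_)
    simpa [scale] using congrFun h i
  have hmk : ∀ (c : kˣ) (x : {x : Option ι → k // x ≠ 0}),
      WeightedProjectiveSpace.mk (coverWeight d) ⟨scale c x.1, hscale0 c x.1 x.2⟩ =
        WeightedProjectiveSpace.mk (coverWeight d) x := fun c x =>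
    (WeightedProjectiveSpace.mk_eq_mk_iff.2
      ⟨algebraMap k _ c, by simp, fun i => by simp [scale]⟩).symm
  rw [← Nat.card_prod]
  refine Nat.card_eq_of_bijective (fun a : S × kˣ =>
    (⟨scale a.2 (Quotient.out a.1.1).1, ?_⟩ : {x : Option ι → k // P x})) ⟨?_, ?_⟩
  · refine (hS ⟨_, hscale0 a.2 _ (Quotient.out a.1.1).2⟩).1 ?_
    rw [hmk, hout]
    exact a.1.2
  · rintro ⟨⟨s, hs⟩, c⟩ ⟨⟨t, ht⟩, e⟩ h
    have h : scale c (Quotient.out s).1 = scale e (Quotient.out t).1 := congrArg Subtype.val h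
    have hst : s = t := (hout s).symm.trans <| (hmk c _).symm.trans <|
      (congrArg (WeightedProjectiveSpace.mk (coverWeight d)) (Subtype.ext h)).trans <|
      (hmk e _).trans (hout t)
    subst hst
    obtain ⟨i, hi⟩ := hP _ ((hS (Quotient.out s)).1 (by rwa [hout]))
    have := congrFun h (some i)
    simp only [scale, coverWeight, pow_one] at this
    have := mul_right_cancel₀ hi this
    simp [Units.ext this]
  · rintro ⟨x, hx⟩
    let s := WeightedProjectiveSpace.mk (coverWeight d) ⟨x, hP0 x hx⟩
    have hs : s ∈ S := (hS ⟨x, hP0 x hx⟩).2 hx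
    obtain ⟨i, hi⟩ := hP _ ((hS (Quotient.out s)).1 (by rwa [hout]))
    obtain ⟨c, hc, hxc⟩ := WeightedProjectiveSpace.mk_eq_mk_iff.1 (hout s)
    -- A nonzero coordinate of weight one forces the scalar, a priori in the algebraic closure, into
    -- `k`.
    have hci : c = algebraMap k _ (x (some i) / (Quotient.out s).1 (some i)) := by
      have := hxc (some i)
      simp only [coverWeight, pow_one] at this
      rw [map_div₀, this, mul_div_cancel_right₀]
      simpa using hi
    have hne : x (some i) / (Quotient.out s).1 (some i) ≠ 0 := fun h => hc (by rw [hci, h, map_zero])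
    refine ⟨⟨⟨s, hs⟩, Units.mk0 _ hne⟩, Subtype.ext (funext fun j => ?_)⟩
    apply (algebraMap k (AlgebraicClosure k)).injective
    rw [hxc j, hci]
    simp [scale]

theorem card_doubleCover [Fintype ι] [DecidableEq ι] [Fintype k] [DecidableEq k] (hk : ringChar k ≠ 2)
    (g : (ι → k) → k) (P : (ι → k) → Prop) [DecidablePred P] :
    (Nat.card {x : Option ι → k // x none ^ 2 = g (fun i => x (some i)) ∧
      P (fun i => x (some i))} : ℤ) = ∑ z : ι → k, if P z then 1 + quadraticChar k (g z) else 0 := by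
  classical
  rw [Nat.card_eq_fintype_card, Fintype.card_subtype, Finset.card_filter, Nat.cast_sum,
    ← Equiv.sum_comp (Equiv.piOptionEquivProd (β := fun _ : Option ι => k)).symm,
    Fintype.sum_prod_type, Finset.sum_comm]
  refine Finset.sum_congr rfl fun z _ => ?_
  rw [← sum_ite_sq_eq hk]
  by_cases h : P z <;> simp [Equiv.piOptionEquivProd, h]

/-- The number of points of a double cover, as a character sum over the affine cone. -/
theorem card_mul_card_sub_one [Fintype ι] [DecidableEq ι] [Fintype k] [DecidableEq k] (hk : ringChar k ≠ 2)
    {d : ℕ} {S : Set (WeightedProjectiveSpace (coverWeight d : Option ι → ℕ) k)}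
    (g : (ι → k) → k) (P : (ι → k) → Prop) [DecidablePred P] (hP : ∀ z, P z → z ≠ 0)
    (hS : ∀ x : {x : Option ι → k // x ≠ 0}, WeightedProjectiveSpace.mk (coverWeight d) x ∈ S ↔
      x.1 none ^ 2 = g (fun i => x.1 (some i)) ∧ P (fun i => x.1 (some i))) :
    (Nat.card S : ℤ) * (Fintype.card k - 1) =
      ∑ z : ι → k, if P z then 1 + quadraticChar k (g z) else 0 := by
  rw [← card_doubleCover hk, ← card_units_mul_card_eq_card_cone (S := S)
    (fun x hx => Function.ne_iff.1 (hP _ hx.2)) hS, Nat.card_eq_fintype_card (α := kˣ),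
    Fintype.card_units, Nat.cast_mul, Nat.cast_sub Fintype.card_pos, Nat.cast_one]

end Cone

/-! ### Point counts of the surfaces, the fibre and the elliptic curve -/

section PointCounts

variable {k : Type} [Field k] [Fintype k] [DecidableEq k]

theorem sum_pi_fin_succ {α : Type} [Fintype α] {n : ℕ} (f : (Fin (n + 1) → α) → ℤ) :
    ∑ z, f z = ∑ a : α, ∑ z : Fin n → α, f (Fin.cons a z) := by
  rw [← Equiv.sum_comp (Fin.consEquiv fun _ => α), Fintype.sum_prod_type]
  rfl

theorem sum_pi_fin_three {α : Type} [Fintype α] (f : (Fin 3 → α) → ℤ) :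
    ∑ z, f z = ∑ a, ∑ b, ∑ c, f ![a, b, c] := by
  simp_rw [sum_pi_fin_succ]
  simp
  rfl

theorem sum_pi_fin_six {α : Type} [Fintype α] (f : (Fin 6 → α) → ℤ) :
    ∑ z, f z = ∑ a, ∑ b, ∑ c, ∑ d, ∑ e, ∑ g, f ![a, b, c, d, e, g] := by
  simp_rw [sum_pi_fin_succ]
  simp
  rfl

theorem card_sub_one_ne_zero {k : Type} [Field k] [Fintype k] : (Fintype.card k : ℤ) - 1 ≠ 0 := by
  have : 1 < Fintype.card k := Fintype.one_lt_card
  omega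

/-- Dehomogenisation of a ternary sextic character sum. -/
theorem sum_quadraticChar_sextic {G : k → k → k → k} (h0 : ∀ x y, G x y 0 = 0)
    (hG : ∀ c x y, G (c * x) (c * y) c = (c ^ 3) ^ 2 * G x y 1) :
    ∑ x : k, ∑ y : k, ∑ c : k, quadraticChar k (G x y c) =
      (Fintype.card k - 1) * ∑ x : k, ∑ y : k, quadraticChar k (G x y 1) := by
  have h : ∀ c : k, ∑ x : k, ∑ y : k, quadraticChar k (G x y c) =
      quadraticChar k c ^ 2 * ∑ x : k, ∑ y : k, quadraticChar k (G x y 1) := fun c => by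
    rcases eq_or_ne c 0 with rfl | hc
    · simp [h0]
    · rw [quadraticChar_sq_one hc, one_mul, ← Equiv.sum_comp (Equiv.mulLeft₀ c hc)]
      refine Finset.sum_congr rfl fun x _ => ?_
      rw [← Equiv.sum_comp (Equiv.mulLeft₀ c hc)]
      refine Finset.sum_congr rfl fun y _ => ?_
      rw [← quadraticChar_sq_mul (pow_ne_zero 3 hc) (G x y 1), ← hG]
      rfl
  have hcomm : ∑ x : k, ∑ y : k, ∑ c : k, quadraticChar k (G x y c) =
      ∑ c : k, ∑ x : k, ∑ y : k, quadraticChar k (G x y c) :=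
    (Finset.sum_congr rfl fun x _ => Finset.sum_comm).trans Finset.sum_comm
  rw [hcomm, Finset.sum_congr rfl fun c _ => h c]
  rw [sum_quadraticChar_sq_mul (fun _ => ∑ x : k, ∑ y : k, quadraticChar k (G x y 1))]
  simp
  ring

theorem card_of_sextic (hk : ringChar k ≠ 2)
    {S : Set (WeightedProjectiveSpace (coverWeight 3 : Option (Fin 3) → ℕ) k)}
    {G : k → k → k → k} (h0 : ∀ x y, G x y 0 = 0)
    (hG : ∀ c x y, G (c * x) (c * y) c = (c ^ 3) ^ 2 * G x y 1)
    (hS : ∀ x : {x : Option (Fin 3) → k // x ≠ 0},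
      WeightedProjectiveSpace.mk (coverWeight 3) x ∈ S ↔
        x.1 none ^ 2 = G (x.1 (some 0)) (x.1 (some 1)) (x.1 (some 2))) :
    (Nat.card S : ℤ) = (Fintype.card k : ℤ) ^ 2 + Fintype.card k + 1 +
      ∑ x : k, ∑ y : k, quadraticChar k (G x y 1) := by
  apply mul_right_cancel₀ (card_sub_one_ne_zero (k := k))
  rw [card_mul_card_sub_one hk (fun z => G (z 0) (z 1) (z 2)) (fun z => z ≠ 0) (fun _ h => h)]
  -- The character term vanishes at the origin, so excluding it costs only 1; q³ - 1 then yields q²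
  -- + q + 1.
  · have hsplit : ∀ z : Fin 3 → k,
        (if z ≠ 0 then 1 + quadraticChar k (G (z 0) (z 1) (z 2)) else 0) =
          (1 - if z = 0 then 1 else 0) + quadraticChar k (G (z 0) (z 1) (z 2)) := fun z => by
      by_cases hz : z = 0
      · subst hz
        simp [h0]
      · simp [hz]
    simp_rw [hsplit]
    rw [Finset.sum_add_distrib, sum_pi_fin_three (fun z => quadraticChar k (G (z 0) (z 1) (z 2)))]
    simp only [Matrix.cons_val]
    rw [sum_quadraticChar_sextic h0 hG]
    simp
    ring
  · intro x
    rw [hS]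
    refine ⟨fun h => ⟨h, fun hz => x.2 ?_⟩, fun h => h.1⟩
    have hz' : ∀ i, x.1 (some i) = 0 := fun i => congrFun hz i
    rw [hz', hz', hz', h0] at h
    funext i
    cases i with
    | none => simpa using h
    | some i => exact hz' i

theorem card_surfaceK (hk : ringChar k ≠ 2) : (Nat.card (surfaceK k) : ℤ) =
    (Fintype.card k : ℤ) ^ 2 + Fintype.card k + 1 + sixLineSum k := by
  rw [card_of_sextic hk (G := fun a b c => a * b * c * (-a + b) * (b + c) * (a + c))]
  · rw [sixLineSum_eq_neg]
    congr 1
    refine Finset.sum_congr rfl fun x _ => Finset.sum_congr rfl fun y _ => ?_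
    congr 1
    ring
  · intros; ring
  · intros; ring
  · intro x
    rw [surfaceK, mk_mem_weightedHypersurface_iff (n := 6)]
    · simp [sub_eq_zero]
    · intro x y c h
      simp only [map_sub, map_mul, map_pow, map_add, map_neg, aeval_X, h, coverWeight]
      ring

theorem card_surfaceL (hk : ringChar k ≠ 2) : (Nat.card (surfaceL k) : ℤ) =
    (Fintype.card k : ℤ) ^ 2 + Fintype.card k + 1 + sixLineSum k := by
  rw [card_of_sextic hk (G := fun a b c => -(a * b * c * (a + b) * (-a + c) * (b + c)))]
  · rw [sixLineSum]
    congr 1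
    refine Finset.sum_congr rfl fun x _ => Finset.sum_congr rfl fun y _ => ?_
    congr 1
    ring
  · intros; ring
  · intros; ring
  · intro x
    rw [surfaceL, mk_mem_weightedHypersurface_iff (n := 6)]
    · simp [sub_eq_zero, -sub_neg_eq_add]
    · intro x y c h
      simp only [map_sub, map_mul, map_pow, map_add, map_neg, aeval_X, h, coverWeight]
      ring

theorem mk_mem_fivefoldFibre_iff {k : Type} [Field k] (lam : k) (x : {x : Option (Fin 6) → k // x ≠ 0}) :
    WeightedProjectiveSpace.mk (coverWeight 6) x ∈ fivefoldFibre k lam ↔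
      x.1 none ^ 2 = ∏ i : Fin 6, x.1 (some i) * (x.1 (some i) + x.1 (some (i + 1))) ∧
      x.1 (some 3) ≠ 0 ∧ x.1 (some 0) = lam * x.1 (some 3) := by
  have hmem : WeightedProjectiveSpace.mk (coverWeight 6) x ∈ fivefold k ↔
      x.1 none ^ 2 = ∏ i : Fin 6, x.1 (some i) * (x.1 (some i) + x.1 (some (i + 1))) := by
    rw [fivefold, mk_mem_weightedHypersurface_iff (n := 12)]
    · simp [sub_eq_zero]
    · intro x y c h
      simp only [map_sub, map_mul, map_pow, map_add, aeval_X, h, coverWeight,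
        Fin.prod_univ_six]
      ring
  refine (and_congr_left' hmem).trans (and_congr_right' ⟨fun h => h x rfl, fun h y hy => ?_⟩)
  obtain ⟨c, hc, hyx⟩ := WeightedProjectiveSpace.mk_eq_mk_iff.1 hy.symm
  have h3 := hyx (some 3)
  have h0 := hyx (some 0)
  simp only [coverWeight, pow_one] at h3 h0
  constructor
  · intro hy3
    rw [hy3, map_zero, eq_comm] at h3
    simp [hc, h.1] at h3
  · apply (algebraMap k (AlgebraicClosure k)).injective
    rw [h0, h.2, map_mul, map_mul, h3]
    ring

theorem prod_cyclic_six {k : Type} [CommRing k] (z : Fin 6 → k) : ∏ i : Fin 6, z i * (z i + z (i + 1)) =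
    z 0 * (z 0 + z 1) * (z 1 * (z 1 + z 2)) * (z 2 * (z 2 + z 3)) * (z 3 * (z 3 + z 4)) *
      (z 4 * (z 4 + z 5)) * (z 5 * (z 5 + z 0)) :=
  Fin.prod_univ_six _

theorem sum_scale_four {k : Type} [Field k] [Fintype k] {a : k} (ha : a ≠ 0) (F : k → k → k → k → ℤ) :
    ∑ b : k, ∑ c : k, ∑ e : k, ∑ g : k, F b c e g =
      ∑ b : k, ∑ c : k, ∑ e : k, ∑ g : k, F (a * b) (a * c) (a * e) (a * g) := by
  have h : ∀ f : k → ℤ, ∑ x : k, f x = ∑ x : k, f (a * x) := fun f =>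
    (Equiv.sum_comp (Equiv.mulLeft₀ a ha) f).symm
  rw [h]
  refine Finset.sum_congr rfl fun b _ => ?_
  rw [h]
  refine Finset.sum_congr rfl fun c _ => ?_
  rw [h]
  exact Finset.sum_congr rfl fun e _ => h _

theorem sum_antidiagonal (H : k → k → k → k → k → k → ℤ) :
    ∑ a : k, ∑ b : k, ∑ c : k, ∑ d : k, ∑ e : k, ∑ g : k,
      (if d ≠ 0 ∧ a = -1 * d then H a b c d e g else 0) =
    ∑ a : k, if a = 0 then 0 else ∑ b : k, ∑ c : k, ∑ e : k, ∑ g : k, H a b c (-a) e g := by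
  have h : ∀ a b c d : k, ∑ e : k, ∑ g : k, (if d ≠ 0 ∧ a = -1 * d then H a b c d e g else 0) =
      if d = -a then (if a = 0 then 0 else ∑ e : k, ∑ g : k, H a b c d e g) else 0 :=
    fun a b c d => by
      by_cases hd : d = -a
      · subst hd
        by_cases ha : a = 0 <;> simp [ha]
      · have : ¬ (a = -1 * d) := fun h => hd (by rw [h]; ring)
        simp only [this, hd, and_false, if_false, Finset.sum_const_zero]
  simp_rw [h]
  refine Finset.sum_congr rfl fun a _ => ?_
  split_ifs <;> simp

theorem card_fivefoldFibre_neg_one (hk : ringChar k ≠ 2) :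
    (Nat.card (fivefoldFibre k (-1)) : ℤ) =
      (Fintype.card k : ℤ) ^ 4 + quadraticChar k (-1) * sixLineSum k ^ 2 := by
  apply mul_right_cancel₀ (card_sub_one_ne_zero (k := k))
  rw [card_mul_card_sub_one hk (fun z => ∏ i : Fin 6, z i * (z i + z (i + 1)))
    (fun z => z 3 ≠ 0 ∧ z 0 = -1 * z 3) (fun z hz h => hz.1 (by simp [h]))
    (mk_mem_fivefoldFibre_iff (-1)),
    sum_pi_fin_six]
  simp only [prod_cyclic_six, Matrix.cons_val]
  rw [sum_antidiagonal fun a b c d e g => 1 + quadraticChar k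
    (a * (a + b) * (b * (b + c)) * (c * (c + d)) * (d * (d + e)) * (e * (e + g)) * (g * (g + a)))]
  have h : ∀ a : k, (if a = 0 then 0 else ∑ b : k, ∑ c : k, ∑ e : k, ∑ g : k,
      (1 + quadraticChar k (a * (a + b) * (b * (b + c)) * (c * (c + -a)) * (-a * (-a + e)) *
        (e * (e + g)) * (g * (g + a))))) = (1 - if a = 0 then 1 else 0) *
      ((Fintype.card k : ℤ) ^ 4 + quadraticChar k (-1) * sixLineSum k ^ 2) := fun a => by
    split_ifs with ha
    · simp
    · rw [sum_scale_four (neg_ne_zero.2 ha) fun b c e g => 1 + quadraticChar k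
        (a * (a + b) * (b * (b + c)) * (c * (c + -a)) * (-a * (-a + e)) * (e * (e + g)) *
          (g * (g + a)))]
      -- Scaling by x₃ = -a extracts a¹² = (a⁶)²; the rest separates into the paths x₁, x₂ and x₅,
      -- x₄, with sign -1 from x₀.
      have hsplit : ∀ b c e g : k, quadraticChar k (a * (a + -a * b) * (-a * b * (-a * b + -a * c)) *
          (-a * c * (-a * c + -a)) * (-a * (-a + -a * e)) * (-a * e * (-a * e + -a * g)) *
          (-a * g * (-a * g + a))) = quadraticChar k (-1) *
          quadraticChar k (b * c * (b - 1) * (b + c) * (c + 1)) *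
          quadraticChar k (g * e * (g - 1) * (g + e) * (e + 1)) := fun b c e g => by
        rw [← map_mul, ← map_mul, ← quadraticChar_sq_mul (pow_ne_zero 6 ha) (-1 * _ * _)]
        congr 1
        ring
      simp_rw [hsplit, Finset.sum_add_distrib, ← Finset.mul_sum]
      simp_rw [Finset.sum_comm (f := fun e g : k =>
        quadraticChar k (g * e * (g - 1) * (g + e) * (e + 1))), ← Finset.sum_mul, ← Finset.mul_sum]
      simp only [← sixLineSum.eq_1]
      simp
      ring
  simp_rw [h]
  rw [← Finset.sum_mul]
  simp
  ring

/-- The discriminant is 2⁶ ≠ 0, so every affine solution is a nonsingular point. -/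
theorem card_curveE_point (hk : ringChar k ≠ 2) :
    (Nat.card (curveE k).Point : ℤ) = Fintype.card k + 1 + cubicSum k := by
  have h2 : (2 : k) ≠ 0 := Ring.two_ne_zero hk
  have hΔ : (curveE k).Δ ≠ 0 := by
    have : (curveE k).Δ = 2 ^ 6 := by
      simp only [WeierstrassCurve.Δ, WeierstrassCurve.b₂, WeierstrassCurve.b₄, WeierstrassCurve.b₆,
        WeierstrassCurve.b₈, curveE]
      ring
    rw [this]
    exact pow_ne_zero 6 h2
  have hns : ∀ x y : k, (curveE k).Nonsingular x y ↔ y ^ 2 = x ^ 3 - x := fun x y => by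
    rw [← WeierstrassCurve.Affine.equation_iff_nonsingular_of_Δ_ne_zero hΔ,
      WeierstrassCurve.Affine.equation_iff]
    simp [curveE, sub_eq_add_neg]
  let e : (curveE k).Point ≃ Option {a : k × k // a.2 ^ 2 = a.1 ^ 3 - a.1} :=
    { toFun := fun P => match P with
        | .zero => none
        | .some x y h => some ⟨(x, y), (hns x y).1 h⟩
      invFun := fun a => match a with
        | none => .zero
        | some a => .some a.1.1 a.1.2 ((hns _ _).2 a.2)
      left_inv := by rintro (_ | _) <;> rfl
      right_inv := by rintro (_ | _) <;> rfl }
  rw [Nat.card_congr e, Nat.card_eq_fintype_card, Fintype.card_option, Fintype.card_subtype,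
    Finset.card_filter, Fintype.sum_prod_type]
  push_cast
  simp_rw [sum_ite_sq_eq hk]
  rw [Finset.sum_add_distrib, cubicSum]
  simp
  ring

end PointCounts

/-! ### Conclusion over the prime field -/

theorem frobTrace_eq_neg_cubicSum (p : ℕ) [Fact p.Prime] (hp : p ≠ 2) :
    frobTrace p = -cubicSum (ZMod p) := by
  rw [frobTrace, card_curveE_point (by rwa [ZMod.ringChar_zmod_n]), ZMod.card]
  ring

theorem proposition3p12 (p : ℕ) [Fact p.Prime] (hp : p ≠ 2) :
    ((Nat.card (surfaceK (ZMod p)) : ℤ) =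
        (p : ℤ) ^ 2 - quadraticChar (ZMod p) (-1) * p + 1 + frobTrace p ^ 2) ∧
    ((Nat.card (surfaceL (ZMod p)) : ℤ) =
        (p : ℤ) ^ 2 - quadraticChar (ZMod p) (-1) * p + 1 + frobTrace p ^ 2) ∧
    (p % 4 = 1 →
      (Nat.card (fivefoldFibre (ZMod p) (-1)) : ℤ) =
        (p : ℤ) ^ 4 + (2 * (p : ℤ) - frobTrace p ^ 2) ^ 2) ∧
    (p % 4 = 3 →
      (Nat.card (fivefoldFibre (ZMod p) (-1)) : ℤ) = (p : ℤ) ^ 4) := by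
  have hk : ringChar (ZMod p) ≠ 2 := by rwa [ZMod.ringChar_zmod_n]
  have hsq := cubicSum_sq hk
  have hneg := sixLineSum_eq_quadraticChar_neg_one_mul (k := ZMod p)
  rw [card_surfaceK hk, card_surfaceL hk, card_fivefoldFibre_neg_one hk,
    frobTrace_eq_neg_cubicSum p hp, neg_sq, hsq, ZMod.card]
  refine ⟨by ring, by ring, fun h => ?_, fun h => ?_⟩
  · have h1 : quadraticChar (ZMod p) (-1) = 1 := by
      rw [quadraticChar_neg_one hk, ZMod.card, ZMod.χ₄_nat_one_mod_four h]
    rw [h1]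
    ring
  · have h1 : quadraticChar (ZMod p) (-1) = -1 := by
      rw [quadraticChar_neg_one hk, ZMod.card, ZMod.χ₄_nat_three_mod_four h]
    rw [h1] at hneg
    have : sixLineSum (ZMod p) = 0 := by linarith
    rw [this]
    ring
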